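/- A city has a finite nonempty set $\mathcal V$ of zones. Given are potential demands $\lambda^0_{ij}>0$ and travel times $t_{ij}>0$ ($i,j\in\mathcal V$), a value of time $\alpha>0$, a logit parameter $\eta>0$, a number $N_0>0$ of potential drivers and a driver supply function $F_d$. Let $F_p$ (defined for positive costs) be positive, continuous and decreasing (not necessarily strictly), and let each $w_i^p$, $i\in\mathcal V$ (defined for positive numbers of idle vehicles), be non-negative, continuous and decreasing (not necessarily strictly). Fix a wage $q>0$ with $F_d(q)>0$, fares $r_i>0$ and idle-AV counts $N_{i,A}^I\ge 0$, and put $N_H:=N_0F_d(q)$. Notation. For idle human-driver counts $N_{i,H}^I$, passenger flows $\lambda_{ij}$, vehicle waiting times $w_i^d$ and a commission rate $\delta$, let $\bar t_i=\sum_j\lambda_{ij}t_{ij}/\sum_j\lambda_{ij}$, $\bar e_i=(1-\delta)r_i\bar t_i$, $s_{ij}=t_{ij}$ for $j\ne i$, $s_{ii}=0$, and $$\mathbb P_{ij}=\frac{\exp\big(\eta\,\bar e_j/(w_j^d+s_{ij}+\bar t_j)\big)}{\sum_{k}\exp\big(\eta\,\bar e_k/(w_k^d+s_{ik}+\bar t_k)\big)},\qquad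 \phi_i^A=\frac{N_{i,A}^I}{N_{i,A}^I+N_{i,H}^I},\quad \phi_i^H=\frac{N_{i,H}^I}{N_{i,A}^I+N_{i,H}^I}.$$ The network equilibrium constraints are, for all $i,j\in\mathcal V$: (a) $\lambda_{ij}=\lambda^0_{ij}F_p\big(\alpha w_i^p(N_i^I)+r_it_{ij}\big)$; (b) $N_i^I=N_{i,A}^I+N_{i,H}^I$; (c) $N_i^I=w_i^d\sum_{j}\lambda_{ij}$; (d) $f_{ij,H}=\mathbb P_{ij}\sum_{k}\phi_k^H\lambda_{ki}$, where $\delta$ is the commission rate corresponding to the wage, i.e. $qN_H=(1-\delta)\sum_{k,l}r_k\lambda_{kl}t_{kl}$; (e) $\sum_j(\phi_j^H\lambda_{ji}+f_{ji,H})=\sum_j(\phi_i^H\lambda_{ij}+f_{ij,H})$; (f) $\sum_j(\phi_j^A\lambda_{ji}+f_{ji,A})=\sum_j(\phi_i^A\lambda_{ij}+f_{ij,A})$; (g) $N_0F_d(q)=\sum_{i,j}\phi_i^H\lambda_{ij}t_{ij}+\sum_{i,j}\phi_i^H\lambda_{ij}w_i^p(N_i^I)+\sum_iN_{i,H}^I$;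 (h) $N_A=\sum_{i,j}\phi_i^A\lambda_{ij}t_{ij}+\sum_{i,j}\phi_i^A\lambda_{ij}w_i^p(N_i^I)+\sum_iN_{i,A}^I$. Assume that for all $i,j\in\mathcal V$ (i) $\lim_{n\to0^+}F_p\big(\alpha w_i^p(n)+r_it_{ij}\big)=0$; (ii) $\lim_{w\to\infty}wF_p\big(\alpha w+r_it_{ij}\big)=0$; (iii) $\displaystyle\sum_{j}f_{ij,H}\le\frac{N_H}{N_{i,A}^I+N_H}\sum_{j}\lambda^0_{ij}F_p\big(\alpha w_i^p(N_H+N_{i,A}^I)+r_it_{ij}\big)$, where the repositioning flows $f_{ij,H}$ are those in the extreme state in which all $N_H$ human drivers are idle and concentrated in zone $i$. Then there exist $N_{i,H}^I>0$, $\lambda_{ij}>0$, $w_i^d>0$, $f_{ij,A}>0$ ($i,j\in\mathcal V$), together with $N_i^I$, $f_{ij,H}$, $\delta$ and $N_A$, that satisfy all the constraints (a)–(h); moreover $N_A>0$ if $N_{i,A}^I>0$ for some $i$. -/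

import Mathlib

open Filter Topology Set

namespace RideSourcing

/-- Exogenous primitives of a ride-sourcing market over the set of zones `V`. The regularity
assumptions on `Fp`, `wp` and `Fd` are hypotheses of the theorem. -/
structure Market (V : Type*) where
  /-- potential passenger demand from zone `i` to zone `j` -/
  lam0 : V → V → ℝ
  /-- average travel time from zone `i` to zone `j` -/
  t : V → V → ℝ
  /-- share of passengers choosing ride-sourcing, as a function of the (positive) trip cost -/
  Fp : ℝ → ℝ
  /-- passenger waiting time in a zone, as a function of the (positive) number of idle vehicles -/
  wp : V → ℝ → ℝ
  /-- passengers' value of time -/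
  α : ℝ
  /-- parameter of the logit model of driver repositioning -/
  η : ℝ
  /-- number of potential drivers -/
  N0 : ℝ
  /-- share of potential drivers who work for the platform, as a function of the wage -/
  Fd : ℝ → ℝ
  lam0_pos : ∀ i j, 0 < lam0 i j
  t_pos : ∀ i j, 0 < t i j
  α_pos : 0 < α
  η_pos : 0 < η
  N0_pos : 0 < N0

/-- The endogenous quantities of the market. -/
structure Outcome (V : Type*) where
  /-- idle human drivers in each zone -/
  NH : V → ℝ
  /-- idle vehicles (of both types) in each zone -/
  NI : V → ℝ
  /-- passenger flows -/
  lam : V → V → ℝ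
  /-- vehicle waiting time between rides in each zone -/
  wd : V → ℝ
  /-- commission rate of the platform -/
  δ : ℝ
  /-- repositioning flows of human drivers -/
  fH : V → V → ℝ
  /-- repositioning flows of AVs -/
  fA : V → V → ℝ
  /-- total number of AVs -/
  NAtot : ℝ

namespace Market

variable {V : Type*} (m : Market V)

/-- Passenger flow `λ_ij` when there are `NI i` idle vehicles in zone `i`. -/
noncomputable def demand (r : V → ℝ) (NI : V → ℝ) (i j : V) : ℝ :=
  m.lam0 i j * m.Fp (m.α * m.wp i (NI i) + r i * m.t i j)

/-- Total number of human drivers at wage `q`. -/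
noncomputable def drivers (q : ℝ) : ℝ := m.N0 * m.Fd q

variable [Fintype V]

/-- Average duration of the trips that start in zone `i`. -/
noncomputable def avgTrip (lam : V → V → ℝ) (i : V) : ℝ :=
  (∑ j, lam i j * m.t i j) / ∑ j, lam i j

/-- Average per-trip earning of a driver in zone `i`. -/
noncomputable def tripEarning (r : V → ℝ) (δ : ℝ) (lam : V → V → ℝ) (i : V) : ℝ :=
  (1 - δ) * r i * m.avgTrip lam i

/-- Expected earning per unit time of an idle driver in zone `i` who heads for zone `j`; a driver
who stays in the zone spends no travel time. -/
noncomputable def earningRate [DecidableEq V] (r : V → ℝ) (δ : ℝ) (lam : V → V → ℝ) (wd : V → ℝ)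
    (i j : V) : ℝ :=
  m.tripEarning r δ lam j / (wd j + (if j = i then 0 else m.t i j) + m.avgTrip lam j)

/-- Logit probability that an idle driver in zone `i` repositions to zone `j`. -/
noncomputable def repositionProb [DecidableEq V] (r : V → ℝ) (δ : ℝ) (lam : V → V → ℝ)
    (wd : V → ℝ) (i j : V) : ℝ :=
  Real.exp (m.η * m.earningRate r δ lam wd i j) /
    ∑ k, Real.exp (m.η * m.earningRate r δ lam wd i k)

/-- Repositioning flow of human drivers: repositioning probability times the arrival rate of human
drivers who drop off a passenger in zone `i`. (With `0 / 0 = 0`, a zone without vehicles sends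
out no human driver.) -/
noncomputable def humanFlow [DecidableEq V] (r : V → ℝ) (δ : ℝ) (NA NH : V → ℝ)
    (lam : V → V → ℝ) (wd : V → ℝ) (i j : V) : ℝ :=
  m.repositionProb r δ lam wd i j * ∑ k, NH k / (NA k + NH k) * lam k i

/-- Total platform revenue per unit time. -/
noncomputable def revenue (r : V → ℝ) (lam : V → V → ℝ) : ℝ := ∑ i, ∑ j, r i * lam i j * m.t i j

/-- The repositioning flow of human drivers as a function of the distribution `NH` of idle human
drivers: passenger flows, vehicle waiting times and commission are those induced by `NH`. -/
noncomputable def inducedHumanFlow [DecidableEq V] (q : ℝ) (r NA NH : V → ℝ) (i j : V) : ℝ :=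
  let lam := m.demand r (NA + NH)
  let wd := fun k => (NA + NH) k / ∑ l, lam k l
  let δ := 1 - q * m.drivers q / m.revenue r lam
  m.humanFlow r δ NA NH lam wd i j

/-- The network equilibrium constraints, given the wage `q`, the fares `r` and the idle AVs `NA`. -/
structure IsEquilibrium [DecidableEq V] (q : ℝ) (r NA : V → ℝ) (o : Outcome V) : Prop where
  /-- passenger demand -/
  demand : ∀ i j, o.lam i j = m.lam0 i j * m.Fp (m.α * m.wp i (o.NI i) + r i * m.t i j)
  /-- idle vehicles -/
  idle : ∀ i, o.NI i = NA i + o.NH i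
  /-- vehicle waiting time -/
  wait : ∀ i, o.NI i = o.wd i * ∑ j, o.lam i j
  /-- repositioning of human drivers -/
  reposition : ∀ i j, o.fH i j = m.humanFlow r o.δ NA o.NH o.lam o.wd i j
  /-- commission rate corresponding to the wage `q` -/
  wage : q * m.drivers q = (1 - o.δ) * m.revenue r o.lam
  /-- flow balance of human drivers: inflow equals outflow in each zone -/
  balanceH : ∀ i,
    ∑ j, (o.NH j / (NA j + o.NH j) * o.lam j i + o.fH j i) =
      ∑ j, (o.NH i / (NA i + o.NH i) * o.lam i j + o.fH i j)
  /-- flow balance of AVs: inflow equals outflow in each zone -/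
  balanceA : ∀ i,
    ∑ j, (NA j / (NA j + o.NH j) * o.lam j i + o.fA j i) =
      ∑ j, (NA i / (NA i + o.NH i) * o.lam i j + o.fA i j)
  /-- conservation of human-driven vehicle hours -/
  hoursH : m.N0 * m.Fd q =
    (∑ i, ∑ j, o.NH i / (NA i + o.NH i) * o.lam i j * m.t i j) +
    (∑ i, ∑ j, o.NH i / (NA i + o.NH i) * o.lam i j * m.wp i (o.NI i)) + ∑ i, o.NH i
  /-- conservation of AV hours -/
  hoursA : o.NAtot =
    (∑ i, ∑ j, NA i / (NA i + o.NH i) * o.lam i j * m.t i j) +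
    (∑ i, ∑ j, NA i / (NA i + o.NH i) * o.lam i j * m.wp i (o.NI i)) + ∑ i, NA i

end Market

end RideSourcing

/-! The distribution `x` of idle human drivers determines passenger flows, waiting times, commission
and human repositioning. AV hours define the fleet size, and AV repositioning is free: any net
inflows summing to zero come from some positive flow (`exists_pos_flow`). What remains is human
balance and human hours.

Logit probabilities sum to one, so drivers leaving a zone empty are exactly those dropping off
there, and balance says that the repositioning inflow equals the pickup rate. Let `G x i` be their
difference; its sum over `i` vanishes identically. With total hours `H` and supply `N`,
`IsRegular.exists_balanced` merges balance and hours into `F x i = G x i + (N - H)⁺ - (x i - ε)(H -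
N)⁺` on a cube `[ε, R]^V`. At `x i = ε` pickups are tiny, while either some zone is well stocked and
logit inflow is bounded below (`IsRegular.exists_le_inflow`), or all zones are nearly empty and `N -
H` is large; so `F x i > 0`. At `x i = R` the last term dominates. The Poincaré–Miranda theorem
gives a zero of `F`; summing over `i` forces `H = N`, hence `G = 0`.

Poincaré–Miranda follows by compactness from Kuhn's cubical Sperner lemma `sum_isFull`, proved by
counting facets modulo 2. -/

/-! ### Kuhn's cubical Sperner lemma: parity in one simplex. -/

namespace KuhnSperner

open Finset Classical in
/-- Among the facets of a simplex with `n + 1` vertices labelled by `0, …, n`, the number of those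
that carry all the nonzero labels is odd if and only if all labels occur. -/
lemma sum_facets {n : ℕ} (f : Fin (n + 1) → ℕ) (hf : ∀ k, f k ≤ n) :
    (∑ k : Fin (n + 1), if ∀ c, 1 ≤ c → c ≤ n → ∃ j ≠ k, f j = c then (1 : ZMod 2) else 0) =
    if ∀ c ≤ n, ∃ j, f j = c then 1 else 0 := by
  have inj : ∀ g : Fin (n + 1) → ℕ, (∀ k, g k ≤ n) → (∀ c ≤ n, ∃ j, g j = c) →
      Function.Injective g := by
    intro g hg hs
    have h1 : Function.Surjective (fun k => (⟨g k, Nat.lt_succ_of_le (hg k)⟩ : Fin (n + 1))) := by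
      intro c
      obtain ⟨j, hj⟩ := hs c (Nat.le_of_lt_succ c.2)
      exact ⟨j, Fin.ext hj⟩
    have h2 := Finite.injective_iff_surjective.2 h1
    intro a b hab
    exact h2 (Fin.ext hab)
  by_cases hfull : ∀ c ≤ n, ∃ j, f j = c
  · rw [if_pos hfull]
    have hi := inj f hf hfull
    obtain ⟨k0, hk0⟩ := hfull 0 (Nat.zero_le _)
    have key : ∀ k, (∀ c, 1 ≤ c → c ≤ n → ∃ j ≠ k, f j = c) ↔ k = k0 := by
      intro k
      constructor
      · intro h
        by_contra hk
        have hne : f k ≠ 0 := fun h0 => hk (hi (h0.trans hk0.symm))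
        obtain ⟨j, hj, hjk⟩ := h (f k) (Nat.one_le_iff_ne_zero.2 hne) (hf k)
        exact hj (hi hjk)
      · rintro rfl c hc hcn
        obtain ⟨j, hj⟩ := hfull c hcn
        refine ⟨j, ?_, hj⟩
        rintro rfl
        omega
    simp [key]
  · rw [if_neg hfull]
    by_cases hex : ∃ k, ∀ c, 1 ≤ c → c ≤ n → ∃ j ≠ k, f j = c
    · obtain ⟨k, hk⟩ := hex
      have hk0 : f k ≠ 0 := by
        intro h0
        apply hfull
        intro c hc
        rcases Nat.eq_zero_or_pos c with rfl | hpos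
        · exact ⟨k, h0⟩
        · obtain ⟨j, -, hj⟩ := hk c hpos hc
          exact ⟨j, hj⟩
      obtain ⟨j, hjk, hj⟩ := hk (f k) (Nat.one_le_iff_ne_zero.2 hk0) (hf k)
      -- Relabelling vertex `k` by `0` makes the labels a bijection. So exactly one other vertex `j`
      -- shares the label of `k`, and precisely the facets opposite to `k` and `j` count, cancelling
      -- modulo 2.
      have hg : Function.Injective (Function.update f k 0) := by
        apply inj
        · intro i
          by_cases hik : i = k
          · subst hik; simp
          · simp [hik, hf i]
        · intro c hc
          rcases Nat.eq_zero_or_pos c with rfl | hpos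
          · exact ⟨k, by simp⟩
          · obtain ⟨i, hik, hi⟩ := hk c hpos hc
            exact ⟨i, by simp [hik, hi]⟩
      have key : ∀ m, (∀ c, 1 ≤ c → c ≤ n → ∃ j ≠ m, f j = c) ↔ m = k ∨ m = j := by
        intro m
        constructor
        · intro h
          by_contra hm
          push Not at hm
          have hm0 : f m ≠ 0 := by
            intro h0
            apply hm.1
            apply hg
            simp [hm.1, h0]
          obtain ⟨i, him, hi⟩ := h (f m) (Nat.one_le_iff_ne_zero.2 hm0) (hf m)
          by_cases hik : i = k
          · subst hik
            apply hm.2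
            apply hg
            simp [hm.1, hjk, hj, hi]
          · apply him
            apply hg
            simp [hm.1, hik, hi]
        · rintro (rfl | rfl)
          · exact hk
          · intro c hc hcn
            obtain ⟨i, hik, hi⟩ := hk c hc hcn
            by_cases hij : i = m
            · subst hij
              exact ⟨k, hjk.symm, by rw [← hj, hi]⟩
            · exact ⟨i, hij, hi⟩
      have hset : (univ.filter fun m => m = k ∨ m = j) = {k, j} := by
        ext m; simp
      simp only [key]
      rw [← Finset.sum_filter, hset, Finset.sum_pair hjk.symm]
      decide
    · push Not at hex
      apply Finset.sum_eq_zero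
      intro k _
      rw [if_neg]
      intro h
      obtain ⟨c, h1, h2, h3⟩ := hex k
      obtain ⟨j, h4, h5⟩ := h c h1 h2
      exact h3 j h4 h5

/-! ### Kuhn simplices and their adjacencies. -/

/-- The `k`-th vertex of the Kuhn simplex with base point `v` and coordinate order `σ`. -/
def vertex {n : ℕ} (v : Fin n → ℕ) (σ : Equiv.Perm (Fin n)) (k : ℕ) : Fin n → ℕ :=
  fun i => v i + if (σ i : ℕ) < k then 1 else 0

/-- The Kuhn simplex `(v, σ)` carries all the labels `0, …, n`. -/
def IsFull {n : ℕ} (l : (Fin n → ℕ) → ℕ) (s : (Fin n → ℕ) × Equiv.Perm (Fin n)) : Prop :=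
  ∀ c ≤ n, ∃ j : Fin (n + 1), l (vertex s.1 s.2 j) = c

/-- The facet opposite to the `k`-th vertex of the Kuhn simplex `(v, σ)` carries all the labels
`1, …, n`. -/
def IsFullFacet {n : ℕ} (l : (Fin n → ℕ) → ℕ) (s : (Fin n → ℕ) × Equiv.Perm (Fin n))
    (k : Fin (n + 1)) : Prop :=
  ∀ c, 1 ≤ c → c ≤ n → ∃ j ≠ k, l (vertex s.1 s.2 j) = c

/-- The Kuhn simplices of the cube `{0, …, N}ⁿ`. -/
def simplices (n N : ℕ) : Finset ((Fin n → ℕ) × Equiv.Perm (Fin n)) :=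
  Fintype.piFinset (fun _ => Finset.range N) ×ˢ Finset.univ

lemma mem_simplices {n N : ℕ} {s : (Fin n → ℕ) × Equiv.Perm (Fin n)} :
    s ∈ simplices n N ↔ ∀ i, s.1 i < N := by
  simp [simplices]

lemma vertex_le {n N : ℕ} {s : (Fin n → ℕ) × Equiv.Perm (Fin n)} (hs : s ∈ simplices n N)
    (k : ℕ) (i : Fin n) : vertex s.1 s.2 k i ≤ N := by
  have := mem_simplices.1 hs i
  unfold vertex
  split_ifs <;> omega

/-- The vertices form a monotone lattice path; exchanging two consecutive unit steps moves only the
vertex between them. -/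
lemma vertex_swap {n : ℕ} (v : Fin n → ℕ) (σ : Equiv.Perm (Fin n)) (a b : Fin n)
    (hab : (b : ℕ) = a + 1) (k : ℕ) (hk : k ≠ b) :
    vertex v (σ.trans (Equiv.swap a b)) k = vertex v σ k := by
  funext i
  unfold vertex
  congr 1
  have : ((Equiv.swap a b (σ i) : Fin n) : ℕ) < k ↔ (σ i : ℕ) < k := by
    rw [Equiv.swap_apply_def]
    split_ifs with h1 h2
    · rw [h1]; omega
    · rw [h2]; omega
    · rfl
  simp only [Equiv.trans_apply, this]

open Classical in
/-- Each interior facet opposite to a middle vertex is shared by exactly two simplices. -/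
lemma sum_middle {n N : ℕ} (l : (Fin n → ℕ) → ℕ) (k : Fin (n + 1)) (hk0 : 0 < (k : ℕ))
    (hkn : (k : ℕ) < n) :
    ∑ s ∈ simplices n N, (if IsFullFacet l s k then (1 : ZMod 2) else 0) = 0 := by
  set a : Fin n := ⟨k - 1, by omega⟩ with ha
  set b : Fin n := ⟨k, hkn⟩ with hb
  have hab : (b : ℕ) = a + 1 := by simp [ha, hb]; omega
  have hne : a ≠ b := by
    intro h
    rw [h] at hab
    omega
  have hface : ∀ s : (Fin n → ℕ) × Equiv.Perm (Fin n),
      IsFullFacet l (s.1, s.2.trans (Equiv.swap a b)) k ↔ IsFullFacet l s k := by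
    intro s
    unfold IsFullFacet
    refine forall_congr' fun c => forall_congr' fun _ => forall_congr' fun _ =>
      exists_congr fun j => and_congr_right fun hj => ?_
    rw [vertex_swap _ _ a b hab]
    intro h
    exact hj (Fin.ext h)
  refine Finset.sum_involution (fun s _ => (s.1, s.2.trans (Equiv.swap a b))) ?_ ?_ ?_ ?_
  · intro s _
    simp only [hface]
    split_ifs <;> decide
  · intro s _ _ h
    have h2 : s.2.trans (Equiv.swap a b) = s.2 := congrArg Prod.snd h
    have h3 := congrArg (fun e => e (s.2.symm a)) h2
    simp at h3
    exact hne h3.symm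
  · intro s hs
    exact mem_simplices.2 (mem_simplices (s := s).1 hs)
  · intro s _
    ext <;> simp

/-- Moving to the neighbour across the facet opposite to the first vertex. -/
def shift {m : ℕ} (s : (Fin (m + 1) → ℕ) × Equiv.Perm (Fin (m + 1))) :
    (Fin (m + 1) → ℕ) × Equiv.Perm (Fin (m + 1)) :=
  (fun i => s.1 i + if s.2 i = 0 then 1 else 0, s.2.trans (finRotate (m + 1)).symm)

/-- Moving to the neighbour across the facet opposite to the last vertex. -/
def unshift {m : ℕ} (s : (Fin (m + 1) → ℕ) × Equiv.Perm (Fin (m + 1))) :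
    (Fin (m + 1) → ℕ) × Equiv.Perm (Fin (m + 1)) :=
  (fun i => s.1 i - if s.2 i = Fin.last m then 1 else 0, s.2.trans (finRotate (m + 1)))

lemma finRotate_eq_zero_iff {m : ℕ} (i : Fin (m + 1)) :
    finRotate (m + 1) i = 0 ↔ i = Fin.last m := by
  rw [← finRotate_last, (finRotate (m + 1)).injective.eq_iff]

lemma finRotate_symm_eq_last_iff {m : ℕ} (i : Fin (m + 1)) :
    (finRotate (m + 1)).symm i = Fin.last m ↔ i = 0 := by
  rw [Equiv.symm_apply_eq, finRotate_last]

lemma val_finRotate_symm {m : ℕ} (i : Fin (m + 1)) (hi : i ≠ 0) :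
    ((finRotate (m + 1)).symm i : ℕ) + 1 = i := by
  have h : (finRotate (m + 1)).symm i ≠ Fin.last m := by
    rwa [Ne, finRotate_symm_eq_last_iff]
  have := coe_finRotate_of_ne_last h
  rw [Equiv.apply_symm_apply] at this
  exact this.symm

lemma unshift_shift {m : ℕ} (s : (Fin (m + 1) → ℕ) × Equiv.Perm (Fin (m + 1))) :
    unshift (shift s) = s := by
  refine Prod.ext ?_ ?_
  · funext i
    simp only [unshift, shift, Equiv.trans_apply, finRotate_symm_eq_last_iff]
    split_ifs <;> simp
  · ext i
    simp [unshift, shift]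

lemma shift_unshift {m : ℕ} (s : (Fin (m + 1) → ℕ) × Equiv.Perm (Fin (m + 1)))
    (h : 0 < s.1 (s.2.symm (Fin.last m))) : shift (unshift s) = s := by
  refine Prod.ext ?_ ?_
  · funext i
    simp only [unshift, shift, Equiv.trans_apply, finRotate_eq_zero_iff]
    split_ifs with hi
    · rw [← hi, Equiv.symm_apply_apply] at h
      omega
    · simp
  · ext i
    simp [unshift, shift]

/-- The shifted path drops its first vertex and makes the step `σ⁻¹ 0` again, at the end, so the
remaining vertices are reindexed by one. -/
lemma vertex_shift {m : ℕ} (s : (Fin (m + 1) → ℕ) × Equiv.Perm (Fin (m + 1))) (k : ℕ)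
    (hk : k ≤ m) : vertex (shift s).1 (shift s).2 k = vertex s.1 s.2 (k + 1) := by
  funext i
  change (s.1 i + if s.2 i = 0 then 1 else 0) +
      (if (((finRotate (m + 1)).symm (s.2 i) : Fin (m + 1)) : ℕ) < k then 1 else 0) =
    s.1 i + if ((s.2 i : Fin (m + 1)) : ℕ) < k + 1 then 1 else 0
  by_cases hi : s.2 i = 0
  · have h := (finRotate_symm_eq_last_iff (s.2 i)).2 hi
    have h1 : ¬ (((finRotate (m + 1)).symm (s.2 i) : Fin (m + 1)) : ℕ) < k := by
      rw [h, Fin.val_last]; omega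
    have h2 : ((s.2 i : Fin (m + 1)) : ℕ) < k + 1 := by rw [hi]; simp
    rw [if_pos hi, if_neg h1, if_pos h2]
  · have h := val_finRotate_symm _ hi
    have h1 : (((finRotate (m + 1)).symm (s.2 i) : Fin (m + 1)) : ℕ) < k ↔
        ((s.2 i : Fin (m + 1)) : ℕ) < k + 1 := by omega
    simp only [if_neg hi, h1, add_zero]

lemma isFullFacet_shift {m : ℕ} (l : (Fin (m + 1) → ℕ) → ℕ)
    (s : (Fin (m + 1) → ℕ) × Equiv.Perm (Fin (m + 1))) :
    IsFullFacet l (shift s) (Fin.last (m + 1)) ↔ IsFullFacet l s 0 := by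
  unfold IsFullFacet
  refine forall_congr' fun c => forall_congr' fun _ => forall_congr' fun _ => ?_
  constructor
  · rintro ⟨j, hj, h⟩
    have hj' : (j : ℕ) < m + 1 := Fin.val_lt_last hj
    rw [vertex_shift s j (by omega)] at h
    exact ⟨⟨j + 1, by omega⟩, fun h0 => Nat.succ_ne_zero _ (congrArg Fin.val h0), h⟩
  · rintro ⟨j, hj, h⟩
    have hj' : (j : ℕ) ≠ 0 := fun h0 => hj (Fin.ext h0)
    have hj2 := j.2
    refine ⟨⟨j - 1, by omega⟩, ?_, ?_⟩
    · simp [Fin.ext_iff]; omega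
    · have h1 : (j : ℕ) - 1 + 1 = j := by omega
      have h2 := vertex_shift s ((j : ℕ) - 1) (by omega)
      rw [h1] at h2
      exact (congrArg l h2).trans h

-- `shift` crosses the facet opposite to the first vertex, which becomes the facet opposite to the
-- last vertex of the neighbour. The two filters say that the neighbour stays in the cube; the
-- second also makes the truncated subtraction in `unshift` exact.
open Classical in
lemma sum_interior_ends {m N : ℕ} (l : (Fin (m + 1) → ℕ) → ℕ) :
    ∑ s ∈ simplices (m + 1) N with s.1 (s.2.symm 0) + 1 < N,
        (if IsFullFacet l s 0 then (1 : ZMod 2) else 0) =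
      ∑ s ∈ simplices (m + 1) N with 0 < s.1 (s.2.symm (Fin.last m)),
        (if IsFullFacet l s (Fin.last (m + 1)) then (1 : ZMod 2) else 0) := by
  refine Finset.sum_nbij' shift unshift ?_ ?_ ?_ ?_ ?_
  · intro s hs
    rw [Finset.mem_filter, mem_simplices] at hs ⊢
    refine ⟨fun i => ?_, ?_⟩
    · have := hs.1 i
      simp only [shift]
      split_ifs with hi
      · rw [← hi, Equiv.symm_apply_apply] at hs
        exact hs.2
      · simpa using this
    · simp [shift]
  · intro s hs
    rw [Finset.mem_filter, mem_simplices] at hs ⊢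
    have h0 : (unshift s).2.symm 0 = s.2.symm (Fin.last m) := by
      simp only [unshift, Equiv.symm_trans_apply]
      rw [(finRotate_symm_eq_last_iff 0).2 rfl]
    refine ⟨fun i => lt_of_le_of_lt (Nat.sub_le _ _) (hs.1 i), ?_⟩
    rw [h0]
    have := hs.1 (s.2.symm (Fin.last m))
    simp only [unshift, Equiv.apply_symm_apply, if_true]
    omega
  · intro s _
    exact unshift_shift s
  · intro s hs
    exact shift_unshift s (Finset.mem_filter.1 hs).2
  · intro s _
    simp only [isFullFacet_shift]

/-! ### Boundary facets and induction on the dimension. -/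

/-- The boundary conditions on a labelling of the grid `{0, …, N}ⁿ` in Kuhn's lemma. -/
structure IsKuhnLabelling (n N : ℕ) (l : (Fin n → ℕ) → ℕ) : Prop where
  le : ∀ v, l v ≤ n
  ne_of_eq_zero : ∀ v, (∀ i, v i ≤ N) → ∀ i : Fin n, v i = 0 → l v ≠ i + 1
  lt_of_eq : ∀ v, (∀ i, v i ≤ N) → ∀ i : Fin n, v i = N → (i : ℕ) < l v

lemma vertex_succ_eq {m N : ℕ} {s : (Fin (m + 1) → ℕ) × Equiv.Perm (Fin (m + 1))}
    (h : s.1 (s.2.symm 0) + 1 = N) (k : ℕ) : vertex s.1 s.2 (k + 1) (s.2.symm 0) = N := by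
  simp [vertex, h]

/-- The facet lies in the face where coordinate `σ⁻¹ (last)` is zero, and there the label belonging
to that coordinate is forbidden. -/
lemma not_isFullFacet_last {m N : ℕ} {l : (Fin (m + 1) → ℕ) → ℕ}
    (hl : IsKuhnLabelling (m + 1) N l) {s : (Fin (m + 1) → ℕ) × Equiv.Perm (Fin (m + 1))}
    (hs : s ∈ simplices (m + 1) N) (h : s.1 (s.2.symm (Fin.last m)) = 0) :
    ¬ IsFullFacet l s (Fin.last (m + 1)) := by
  intro hf
  obtain ⟨j, hj, hlj⟩ := hf (s.2.symm (Fin.last m) + 1) (by omega) (by omega)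
  refine hl.ne_of_eq_zero _ (vertex_le hs j) (s.2.symm (Fin.last m)) ?_ hlj
  have hj' : (j : ℕ) < m + 1 := Fin.val_lt_last hj
  simp [vertex, h]
  omega

/-- The facet lies in a face `xᵢ = N` with `i ≠ 0`, where every label exceeds `i ≥ 1`; label `1` is
therefore missing. -/
lemma not_isFullFacet_zero {m N : ℕ} {l : (Fin (m + 1) → ℕ) → ℕ}
    (hl : IsKuhnLabelling (m + 1) N l) {s : (Fin (m + 1) → ℕ) × Equiv.Perm (Fin (m + 1))}
    (hs : s ∈ simplices (m + 1) N) (h : s.1 (s.2.symm 0) + 1 = N) (h0 : s.2.symm 0 ≠ 0) :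
    ¬ IsFullFacet l s 0 := by
  intro hf
  obtain ⟨j, hj, hlj⟩ := hf 1 le_rfl (by omega)
  have hj' : (j : ℕ) ≠ 0 := fun h0 => hj (Fin.ext h0)
  obtain ⟨k, hk⟩ := Nat.exists_eq_succ_of_ne_zero hj'
  have h1 := hl.lt_of_eq _ (vertex_le hs j) (s.2.symm 0) (by rw [hk]; exact vertex_succ_eq h k)
  rw [hlj] at h1
  exact h0 (Fin.ext (by simpa using h1))

/-- The labelling induced on the face `x₀ = N`. -/
def faceLabel {m : ℕ} (N : ℕ) (l : (Fin (m + 1) → ℕ) → ℕ) (u : Fin m → ℕ) : ℕ :=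
  l (Fin.cons N u) - 1

lemma IsKuhnLabelling.face {m N : ℕ} {l : (Fin (m + 1) → ℕ) → ℕ}
    (hl : IsKuhnLabelling (m + 1) N l) : IsKuhnLabelling m N (faceLabel N l) := by
  have hle : ∀ u : Fin m → ℕ, (∀ i, u i ≤ N) →
      ∀ i, (Fin.cons N u : Fin (m + 1) → ℕ) i ≤ N := by
    intro u hu i
    refine Fin.cases ?_ (fun i => ?_) i
    · simp
    · simpa using hu i
  refine ⟨fun u => ?_, fun u hu i hi => ?_, fun u hu i hi => ?_⟩
  · have := hl.le (Fin.cons N u)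
    unfold faceLabel
    omega
  · have := hl.ne_of_eq_zero _ (hle u hu) i.succ (by simpa using hi)
    unfold faceLabel
    simp at this
    omega
  · have := hl.lt_of_eq _ (hle u hu) i.succ (by simpa using hi)
    unfold faceLabel
    simp at this
    omega

/-- The Kuhn simplex with a facet on the face `x₀ = M + 1` that extends a given simplex of that
face. -/
def extend {m : ℕ} (M : ℕ) (s : (Fin m → ℕ) × Equiv.Perm (Fin m)) :
    (Fin (m + 1) → ℕ) × Equiv.Perm (Fin (m + 1)) :=
  (Fin.cons M s.1, Equiv.Perm.decomposeFin.symm (0, s.2))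

lemma vertex_extend {m : ℕ} (M : ℕ) (s : (Fin m → ℕ) × Equiv.Perm (Fin m)) (k : ℕ) :
    vertex (extend M s).1 (extend M s).2 (k + 1) = Fin.cons (M + 1) (vertex s.1 s.2 k) := by
  funext i
  refine Fin.cases ?_ (fun i => ?_) i
  · simp [vertex, extend]
  · simp [vertex, extend, Equiv.Perm.decomposeFin_symm_apply_succ]

lemma isFullFacet_extend {m M : ℕ} {l : (Fin (m + 1) → ℕ) → ℕ}
    (hl : IsKuhnLabelling (m + 1) (M + 1) l) {s : (Fin m → ℕ) × Equiv.Perm (Fin m)}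
    (hs : s ∈ simplices m (M + 1)) :
    IsFullFacet l (extend M s) 0 ↔ IsFull (faceLabel (M + 1) l) s := by
  -- On the face `x₀ = M + 1` all labels are positive, so the truncated subtraction in `faceLabel`
  -- loses nothing.
  have key : ∀ k : ℕ, l (vertex (extend M s).1 (extend M s).2 (k + 1)) =
      faceLabel (M + 1) l (vertex s.1 s.2 k) + 1 := by
    intro k
    rw [vertex_extend, faceLabel, Nat.sub_add_cancel]
    refine hl.lt_of_eq _ (fun i => ?_) 0 (by simp)
    refine Fin.cases ?_ (fun i => ?_) i
    · simp
    · simpa using vertex_le hs k i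
  constructor
  · intro h c hc
    obtain ⟨j, hj, hlj⟩ := h (c + 1) (by omega) (by omega)
    obtain ⟨i, rfl⟩ := Fin.exists_succ_eq.2 hj
    refine ⟨i, ?_⟩
    rw [Fin.val_succ, key] at hlj
    omega
  · intro h c hc hcm
    obtain ⟨j, hj⟩ := h (c - 1) (by omega)
    refine ⟨j.succ, Fin.succ_ne_zero j, ?_⟩
    rw [Fin.val_succ, key]
    omega

open Classical in
lemma sum_face {m M : ℕ} {l : (Fin (m + 1) → ℕ) → ℕ}
    (hl : IsKuhnLabelling (m + 1) (M + 1) l) :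
    ∑ s ∈ simplices (m + 1) (M + 1) with s.1 0 = M ∧ s.2 0 = 0,
        (if IsFullFacet l s 0 then (1 : ZMod 2) else 0) =
      ∑ s ∈ simplices m (M + 1), (if IsFull (faceLabel (M + 1) l) s then (1 : ZMod 2) else 0) := by
  symm
  refine Finset.sum_nbij' (extend M)
    (fun s => (Fin.tail s.1, (Equiv.Perm.decomposeFin s.2).2)) ?_ ?_ ?_ ?_ ?_
  · intro s hs
    rw [mem_simplices] at hs
    rw [Finset.mem_filter, mem_simplices]
    refine ⟨fun i => ?_, by simp [extend], by simp [extend]⟩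
    refine Fin.cases ?_ (fun i => ?_) i
    · simp [extend]
    · simpa [extend] using hs i
  · intro s hs
    rw [Finset.mem_filter, mem_simplices] at hs
    exact mem_simplices.2 fun i => hs.1 i.succ
  · intro s _
    simp [extend]
  · intro s hs
    rw [Finset.mem_filter] at hs
    refine Prod.ext ?_ ?_
    · simp only [extend, ← hs.2.1, Fin.cons_self_tail]
    · simp only [extend]
      rw [Equiv.symm_apply_eq]
      refine Prod.ext ?_ rfl
      rw [← Equiv.Perm.decomposeFin_symm_apply_zero (Equiv.Perm.decomposeFin s.2).1
        (Equiv.Perm.decomposeFin s.2).2, Prod.mk.eta, Equiv.symm_apply_apply, hs.2.2]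
  · intro s hs
    simp only [isFullFacet_extend hl hs]

open Classical in
/-- **Kuhn's cubical Sperner lemma**: the number of fully labelled simplices is odd. -/
theorem sum_isFull (M : ℕ) : ∀ (n : ℕ) (l : (Fin n → ℕ) → ℕ), IsKuhnLabelling n (M + 1) l →
    ∑ s ∈ simplices n (M + 1), (if IsFull l s then (1 : ZMod 2) else 0) = 1
  | 0, l, hl => by
    have h : ∀ s, IsFull l s := fun s c hc => ⟨0, by
      have := hl.le (vertex s.1 s.2 0)
      simp only [Fin.val_zero]
      omega⟩
    simp [h, simplices]
  | m + 1, l, hl => by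
    have hfacets : ∀ s, (if IsFull l s then (1 : ZMod 2) else 0) =
        ∑ k : Fin (m + 1 + 1), if IsFullFacet l s k then (1 : ZMod 2) else 0 := by
      intro s
      have h := sum_facets (fun k : Fin (m + 1 + 1) => l (vertex s.1 s.2 k)) (fun k => hl.le _)
      convert h.symm <;> exact Iff.rfl
    have hlast : ∑ s ∈ simplices (m + 1) (M + 1),
        (if IsFullFacet l s (Fin.last (m + 1)) then (1 : ZMod 2) else 0) =
        ∑ s ∈ simplices (m + 1) (M + 1) with 0 < s.1 (s.2.symm (Fin.last m)),
          (if IsFullFacet l s (Fin.last (m + 1)) then (1 : ZMod 2) else 0) := by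
      refine (Finset.sum_filter_of_ne fun s hs hne => ?_).symm
      by_contra h0
      exact hne (if_neg (not_isFullFacet_last hl hs (by omega)))
    have hfirst : ∑ s ∈ simplices (m + 1) (M + 1) with ¬ s.1 (s.2.symm 0) + 1 < M + 1,
          (if IsFullFacet l s 0 then (1 : ZMod 2) else 0) =
        ∑ s ∈ simplices (m + 1) (M + 1) with s.1 0 = M ∧ s.2 0 = 0,
          (if IsFullFacet l s 0 then (1 : ZMod 2) else 0) := by
      symm
      refine Finset.sum_subset (fun s hs => ?_) (fun s hs hs' => ?_)
      · rw [Finset.mem_filter] at hs ⊢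
        have h0 : s.2.symm 0 = 0 := by rw [Equiv.symm_apply_eq, hs.2.2]
        exact ⟨hs.1, by rw [h0, hs.2.1]; omega⟩
      · rw [Finset.mem_filter] at hs hs'
        have h1 : s.1 (s.2.symm 0) + 1 = M + 1 := by
          have := mem_simplices.1 hs.1 (s.2.symm 0)
          omega
        refine if_neg (not_isFullFacet_zero hl hs.1 h1 fun h0 => hs' ⟨hs.1, ?_, ?_⟩)
        · rw [h0] at h1
          omega
        · exact ((Equiv.symm_apply_eq _).1 h0).symm
    -- After exchanging sums, middle facets vanish, interior first facets cancel against last facets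
    -- in characteristic 2, and only the face `x₀ = M + 1` survives, to which induction applies.
    rw [Finset.sum_congr rfl fun s _ => hfacets s, Finset.sum_comm, Fin.sum_univ_succ,
      Fin.sum_univ_castSucc, Finset.sum_eq_zero (s := Finset.univ), zero_add, Fin.succ_last, hlast,
      ← sum_interior_ends, ← Finset.sum_filter_add_sum_filter_not _
        (fun s : (Fin (m + 1) → ℕ) × Equiv.Perm (Fin (m + 1)) => s.1 (s.2.symm 0) + 1 < M + 1),
      add_right_comm, CharTwo.add_self_eq_zero, zero_add, hfirst, sum_face hl]
    · exact sum_isFull M m _ hl.face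
    · intro k _
      have := k.2
      exact sum_middle l _ (by simp) (by simp)

theorem exists_isFull {M n : ℕ} {l : (Fin n → ℕ) → ℕ} (hl : IsKuhnLabelling n (M + 1) l) :
    ∃ s ∈ simplices n (M + 1), IsFull l s := by
  classical
  by_contra! h
  have h1 := sum_isFull M n l hl
  rw [Finset.sum_eq_zero fun s hs => if_neg (h s hs)] at h1
  exact zero_ne_one h1

end KuhnSperner

/-! ### The Poincaré–Miranda theorem. -/

namespace PoincareMiranda

open KuhnSperner

variable {V : Type*}

/-- The point of the cube `[a, b]^V` that corresponds to a point of the grid `{0, …, M + 1}ⁿ`. -/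
noncomputable def gridPoint {n : ℕ} (e : V ≃ Fin n) (a b : ℝ) (M : ℕ) (v : Fin n → ℕ) : V → ℝ :=
  fun i => a + (b - a) * (v (e i) / (M + 1))

lemma gridPoint_mem {n : ℕ} (e : V ≃ Fin n) {a b : ℝ} (hab : a < b) {M : ℕ} {v : Fin n → ℕ}
    (hv : ∀ i, v i ≤ M + 1) : gridPoint e a b M v ∈ Icc (fun _ => a) (fun _ => b) := by
  have hM : (0 : ℝ) < M + 1 := by positivity
  refine ⟨fun i => ?_, fun i => ?_⟩
  · have : 0 ≤ (b - a) * (v (e i) / (M + 1)) := mul_nonneg (by linarith) (by positivity)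
    simp only [gridPoint]
    linarith
  · have h1 : (v (e i) / (M + 1) : ℝ) ≤ 1 := by
      rw [div_le_one hM]
      exact_mod_cast hv (e i)
    have : (b - a) * (v (e i) / (M + 1)) ≤ (b - a) * 1 :=
      mul_le_mul_of_nonneg_left h1 (by linarith)
    simp only [gridPoint]
    linarith

lemma dist_gridPoint_vertex [Fintype V] {n : ℕ} (e : V ≃ Fin n) {a b : ℝ} (hab : a < b) (M : ℕ)
    (s : (Fin n → ℕ) × Equiv.Perm (Fin n)) (j k : ℕ) :
    dist (gridPoint e a b M (vertex s.1 s.2 j)) (gridPoint e a b M (vertex s.1 s.2 k)) ≤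
      (b - a) * (1 / (M + 1)) := by
  have hM : (0 : ℝ) < M + 1 := by positivity
  have hb : 0 ≤ b - a := by linarith
  rw [dist_pi_le_iff (by positivity)]
  intro i
  have h1 : gridPoint e a b M (vertex s.1 s.2 j) i - gridPoint e a b M (vertex s.1 s.2 k) i =
      (b - a) * ((((vertex s.1 s.2 j (e i) : ℕ) : ℝ) - (vertex s.1 s.2 k (e i) : ℕ)) /
        (M + 1)) := by
    simp only [gridPoint]
    ring
  rw [Real.dist_eq, h1, abs_mul, abs_of_nonneg hb, abs_div, abs_of_pos hM]
  gcongr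
  simp only [vertex]
  push_cast
  split_ifs <;> simp

open Classical in
/-- The largest index (counted from `1`) of a coordinate of `F` that is nonpositive. -/
noncomputable def signLabel {n : ℕ} (e : V ≃ Fin n) (a b : ℝ) (M : ℕ)
    (F : (V → ℝ) → V → ℝ) (v : Fin n → ℕ) : ℕ :=
  Finset.univ.sup fun i : Fin n =>
    if F (gridPoint e a b M v) (e.symm i) ≤ 0 then (i : ℕ) + 1 else 0

lemma signLabel_eq_succ {n : ℕ} {e : V ≃ Fin n} {a b : ℝ} {M : ℕ} {F : (V → ℝ) → V → ℝ}
    {v : Fin n → ℕ} {i : Fin n} (h : signLabel e a b M F v = i + 1) :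
    F (gridPoint e a b M v) (e.symm i) ≤ 0 := by
  classical
  obtain ⟨k, -, hk⟩ := Finset.exists_mem_eq_sup (Finset.univ : Finset (Fin n)) ⟨i, by simp⟩
    fun i : Fin n => if F (gridPoint e a b M v) (e.symm i) ≤ 0 then (i : ℕ) + 1 else 0
  unfold signLabel at h
  rw [h] at hk
  split_ifs at hk with hF
  have : i = k := Fin.ext (by omega)
  rwa [this]

lemma lt_signLabel {n : ℕ} {e : V ≃ Fin n} {a b : ℝ} {M : ℕ} {F : (V → ℝ) → V → ℝ}
    {v : Fin n → ℕ} {i : Fin n} (h : F (gridPoint e a b M v) (e.symm i) ≤ 0) :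
    (i : ℕ) < signLabel e a b M F v := by
  classical
  have := Finset.le_sup (f := fun i : Fin n =>
    if F (gridPoint e a b M v) (e.symm i) ≤ 0 then (i : ℕ) + 1 else 0) (Finset.mem_univ i)
  simp only [if_pos h] at this
  exact this

lemma isKuhnLabelling_signLabel {n : ℕ} (e : V ≃ Fin n) {a b : ℝ} (hab : a < b) (M : ℕ)
    {F : (V → ℝ) → V → ℝ}
    (ha : ∀ x ∈ Icc (fun _ : V => a) (fun _ => b), ∀ i, x i = a → 0 < F x i)
    (hb : ∀ x ∈ Icc (fun _ : V => a) (fun _ => b), ∀ i, x i = b → F x i < 0) :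
    IsKuhnLabelling n (M + 1) (signLabel e a b M F) := by
  have hM : ((M : ℝ) + 1) ≠ 0 := by positivity
  refine ⟨fun v => ?_, fun v hv i hi h => ?_, fun v hv i hi => lt_signLabel ?_⟩
  · refine Finset.sup_le fun i _ => ?_
    have := i.2
    split_ifs <;> omega
  · refine (signLabel_eq_succ h).not_gt (ha _ (gridPoint_mem e hab hv) _ ?_)
    simp [gridPoint, hi]
  · refine (hb _ (gridPoint_mem e hab hv) _ ?_).le
    simp [gridPoint, hi, hM]

/-- The **Poincaré–Miranda theorem** on the cube `[a, b]^V`. -/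
theorem exists_eq_zero [Fintype V] {a b : ℝ} (hab : a < b) {F : (V → ℝ) → V → ℝ}
    (hF : ContinuousOn F (Icc (fun _ => a) (fun _ => b)))
    (ha : ∀ x ∈ Icc (fun _ : V => a) (fun _ => b), ∀ i, x i = a → 0 < F x i)
    (hb : ∀ x ∈ Icc (fun _ : V => a) (fun _ => b), ∀ i, x i = b → F x i < 0) :
    ∃ x ∈ Icc (fun _ : V => a) (fun _ => b), F x = 0 := by
  set K := Icc (fun _ : V => a) (fun _ => b)
  let e := Fintype.equivFin V
  -- In a fully labelled simplex, `z` is the vertex labelled `0`, where no coordinate of `F` is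
  -- nonpositive, and `y i` the vertex whose label certifies `F (y i) i ≤ 0`. As the mesh shrinks,
  -- all of them converge to the same point along a subsequence.
  have step : ∀ M : ℕ, ∃ (z : V → ℝ) (y : V → V → ℝ), z ∈ K ∧ (∀ i, y i ∈ K) ∧
      (∀ i, 0 ≤ F z i) ∧ (∀ i, F (y i) i ≤ 0) ∧ ∀ i, dist z (y i) ≤ (b - a) * (1 / (M + 1)) := by
    intro M
    obtain ⟨s, hs, hfull⟩ := exists_isFull (isKuhnLabelling_signLabel e hab M ha hb)
    choose j hj using hfull
    refine ⟨gridPoint e a b M (vertex s.1 s.2 (j 0 (Nat.zero_le _))),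
      fun i => gridPoint e a b M (vertex s.1 s.2 (j (e i + 1) (e i).2)),
      gridPoint_mem e hab (vertex_le hs _), fun i => gridPoint_mem e hab (vertex_le hs _),
      fun i => ?_, fun i => ?_, fun i => dist_gridPoint_vertex e hab M s _ _⟩
    · by_contra! h
      rw [← e.symm_apply_apply i] at h
      have h1 := lt_signLabel h.le
      rw [hj] at h1
      exact Nat.not_lt_zero _ h1
    · have := signLabel_eq_succ (hj (e i + 1) (e i).2)
      rwa [e.symm_apply_apply] at this
  choose z y hz hy hFz hFy hd using step
  obtain ⟨x, hx, φ, hφ, hlim⟩ :=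
    (isCompact_Icc (a := fun _ : V => a) (b := fun _ => b)).tendsto_subseq hz
  have hlim' : ∀ i, Tendsto (fun k => y (φ k) i) atTop (𝓝 x) := by
    intro i
    refine hlim.congr_dist ?_
    have h0 : Tendsto (fun M : ℕ => (b - a) * (1 / ((M : ℝ) + 1))) atTop (𝓝 0) := by
      simpa using tendsto_one_div_add_atTop_nhds_zero_nat.const_mul (b - a)
    exact squeeze_zero (fun _ => dist_nonneg) (fun k => hd (φ k) i) (h0.comp hφ.tendsto_atTop)
  refine ⟨x, hx, funext fun i => le_antisymm ?_ ?_⟩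
  · have h1 : Tendsto (fun k => F (y (φ k) i)) atTop (𝓝 (F x)) :=
      (hF x hx).tendsto.comp (tendsto_nhdsWithin_iff.2
        ⟨hlim' i, Eventually.of_forall fun k => hy _ i⟩)
    exact le_of_tendsto (tendsto_pi_nhds.1 h1 i) (Eventually.of_forall fun k => hFy _ i)
  · have h1 : Tendsto (fun k => F (z (φ k))) atTop (𝓝 (F x)) :=
      (hF x hx).tendsto.comp (tendsto_nhdsWithin_iff.2
        ⟨hlim, Eventually.of_forall fun k => hz _⟩)
    exact ge_of_tendsto (tendsto_pi_nhds.1 h1 i) (Eventually.of_forall fun k => hFz _ i)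

end PoincareMiranda

/-! ### Passenger flows and waiting times near zero idle vehicles. -/

namespace RideSourcing

namespace Market

variable {V : Type*} (m : Market V)

/-- The standing assumptions on fares, demand and passenger waiting times. -/
structure IsRegular (r : V → ℝ) : Prop where
  fare_pos : ∀ i, 0 < r i
  Fp_pos : ∀ c, 0 < c → 0 < m.Fp c
  Fp_cont : ContinuousOn m.Fp (Ioi 0)
  Fp_anti : AntitoneOn m.Fp (Ioi 0)
  wp_nonneg : ∀ i n, 0 < n → 0 ≤ m.wp i n
  wp_cont : ∀ i, ContinuousOn (m.wp i) (Ioi 0)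
  wp_anti : ∀ i, AntitoneOn (m.wp i) (Ioi 0)
  noIdle : ∀ i j, Tendsto (fun n : ℝ => m.Fp (m.α * m.wp i n + r i * m.t i j)) (𝓝[>] 0) (𝓝 0)
  longWait : ∀ i j, Tendsto (fun w : ℝ => w * m.Fp (m.α * w + r i * m.t i j)) atTop (𝓝 0)

/-- Passenger flow from zone `i` to zone `j` when there are `n` idle vehicles in zone `i`. -/
noncomputable def flow (r : V → ℝ) (i j : V) (n : ℝ) : ℝ :=
  m.lam0 i j * m.Fp (m.α * m.wp i n + r i * m.t i j)

section flow

variable {m} {r NA : V → ℝ}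

lemma IsRegular.fare_mul_pos (h : m.IsRegular r) (i j : V) : 0 < r i * m.t i j :=
  mul_pos (h.fare_pos i) (m.t_pos i j)

lemma IsRegular.cost_pos (h : m.IsRegular r) (i j : V) {n : ℝ} (hn : 0 < n) :
    0 < m.α * m.wp i n + r i * m.t i j :=
  add_pos_of_nonneg_of_pos (mul_nonneg m.α_pos.le (h.wp_nonneg i n hn)) (h.fare_mul_pos i j)

lemma IsRegular.flow_pos (h : m.IsRegular r) (i j : V) {n : ℝ} (hn : 0 < n) :
    0 < m.flow r i j n :=
  mul_pos (m.lam0_pos i j) (h.Fp_pos _ (h.cost_pos i j hn))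

lemma IsRegular.flow_le (h : m.IsRegular r) (i j : V) {n : ℝ} (hn : 0 < n) :
    m.flow r i j n ≤ m.lam0 i j * m.Fp (r i * m.t i j) := by
  refine mul_le_mul_of_nonneg_left ?_ (m.lam0_pos i j).le
  refine h.Fp_anti (h.fare_mul_pos i j) (h.cost_pos i j hn) ?_
  have := mul_nonneg m.α_pos.le (h.wp_nonneg i n hn)
  linarith

lemma IsRegular.flow_mono (h : m.IsRegular r) (i j : V) : MonotoneOn (m.flow r i j) (Ioi 0) := by
  intro a ha b hb hab
  refine mul_le_mul_of_nonneg_left ?_ (m.lam0_pos i j).le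
  refine h.Fp_anti (h.cost_pos i j hb) (h.cost_pos i j ha) ?_
  have := mul_le_mul_of_nonneg_left (h.wp_anti i ha hb hab) m.α_pos.le
  linarith

lemma IsRegular.flow_continuousOn (h : m.IsRegular r) (i j : V) :
    ContinuousOn (m.flow r i j) (Ioi 0) := by
  refine continuousOn_const.mul (h.Fp_cont.comp ?_ fun n hn => h.cost_pos i j hn)
  exact (continuousOn_const.mul (h.wp_cont i)).add continuousOn_const

lemma IsRegular.tendsto_flow (h : m.IsRegular r) (i j : V) :
    Tendsto (m.flow r i j) (𝓝[>] 0) (𝓝 0) := by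
  have h1 := (h.noIdle i j).const_mul (m.lam0 i j)
  rwa [mul_zero] at h1

/-- If waiting times stayed below `M`, then by monotonicity the demand share would stay above its
positive value at waiting time `M`, contradicting `noIdle`. This lets `longWait` be applied along `n
→ 0⁺`. -/
lemma IsRegular.tendsto_wp (h : m.IsRegular r) (i : V) :
    Tendsto (m.wp i) (𝓝[>] 0) atTop := by
  rw [tendsto_atTop]
  intro M
  by_cases hM : ∃ s, 0 < s ∧ M ≤ m.wp i s
  · obtain ⟨s, hs, hMs⟩ := hM
    filter_upwards [Ioo_mem_nhdsGT hs] with n hn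
    exact hMs.trans (h.wp_anti i hn.1 hs hn.2.le)
  · push Not at hM
    have hM0 : 0 < M := (h.wp_nonneg i 1 one_pos).trans_lt (hM 1 one_pos)
    have hpos : 0 < m.α * M + r i * m.t i i :=
      add_pos (mul_pos m.α_pos hM0) (h.fare_mul_pos i i)
    have hle : m.Fp (m.α * M + r i * m.t i i) ≤ 0 := by
      refine ge_of_tendsto (h.noIdle i i) ?_
      filter_upwards [self_mem_nhdsWithin] with n hn
      refine h.Fp_anti (h.cost_pos i i hn) hpos ?_
      have := mul_le_mul_of_nonneg_left (hM n hn).le m.α_pos.le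
      linarith
    exact absurd (h.Fp_pos _ hpos) hle.not_gt

lemma IsRegular.tendsto_flow_mul_wp (h : m.IsRegular r) (i j : V) :
    Tendsto (fun n => m.flow r i j n * m.wp i n) (𝓝[>] 0) (𝓝 0) := by
  have h1 := ((h.longWait i j).comp (h.tendsto_wp i)).const_mul (m.lam0 i j)
  rw [mul_zero] at h1
  refine h1.congr fun n => ?_
  simp only [flow, Function.comp_apply]
  ring

lemma IsRegular.demand_pos (h : m.IsRegular r) (hNA : ∀ i, 0 ≤ NA i)
    {x : V → ℝ} (hx : ∀ i, 0 < x i) (i j : V) : 0 < m.demand r (NA + x) i j :=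
  h.flow_pos i j (by have := hNA i; have := hx i; simp; linarith)

end flow

lemma share_mono {N : ℝ} (hN : 0 ≤ N) : MonotoneOn (fun s : ℝ => s / (N + s)) (Ioi 0) := by
  intro a ha b hb hab
  have ha' : (0 : ℝ) < a := ha
  have hb' : (0 : ℝ) < b := hb
  change a / (N + a) ≤ b / (N + b)
  rw [div_le_div_iff₀ (by linarith) (by linarith)]
  nlinarith

lemma share_continuousOn {N : ℝ} (hN : 0 ≤ N) :
    ContinuousOn (fun s : ℝ => s / (N + s)) (Ioi 0) := by
  refine continuousOn_id.div (continuousOn_const.add continuousOn_id) fun s hs => ?_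
  have : (0 : ℝ) < s := hs
  exact (by linarith : 0 < N + s).ne'

lemma comp_add_continuousOn {N : ℝ} (hN : 0 ≤ N) {f : ℝ → ℝ} (hf : ContinuousOn f (Ioi 0)) :
    ContinuousOn (fun s : ℝ => f (N + s)) (Ioi 0) :=
  hf.comp (continuousOn_const.add continuousOn_id) fun s hs => by
    have : (0 : ℝ) < s := hs
    change 0 < N + s
    linarith

/-- For `N = 0` the share is `1` and `f` itself tends to zero; for `N > 0` the share tends to zero
while `f` stays continuous at `N`. -/
lemma tendsto_share_mul {N : ℝ} (hN : 0 ≤ N) {f : ℝ → ℝ} (hf : ContinuousOn f (Ioi 0))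
    (hf0 : Tendsto f (𝓝[>] 0) (𝓝 0)) :
    Tendsto (fun s : ℝ => s / (N + s) * f (N + s)) (𝓝[>] 0) (𝓝 0) := by
  rcases hN.eq_or_lt with rfl | hN
  · refine hf0.congr' ?_
    filter_upwards [self_mem_nhdsWithin] with s hs
    have hs' : (0 : ℝ) < s := hs
    rw [zero_add, div_self hs'.ne', one_mul]
  · have h1 : ContinuousAt (fun s : ℝ => s / (N + s) * f (N + s)) 0 := by
      have h2 : ContinuousAt f (N + 0) := by
        rw [add_zero]
        exact hf.continuousAt (Ioi_mem_nhds hN)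
      have h3 : ContinuousAt (fun s : ℝ => N + s) 0 := by fun_prop
      refine ContinuousAt.mul (continuousAt_id.div h3 (by simpa using hN.ne')) ?_
      exact ContinuousAt.comp (f := fun s : ℝ => N + s) h2 h3
    have := h1.tendsto
    simp only [zero_div, zero_mul] at this
    exact this.mono_left nhdsWithin_le_nhds

/-! ### Pickup rates, driver hours, drop-offs and revenue. -/

variable [Fintype V]

/-- Rate at which human drivers pick up passengers in zone `i`, as a function of the number `s`
of idle human drivers there. -/
noncomputable def pickup (r NA : V → ℝ) (i : V) (s : ℝ) : ℝ :=
  s / (NA i + s) * ∑ j, m.flow r i j (NA i + s)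

/-- Human driver hours spent idle in zone `i` or on trips from there, as a function of the number
`s` of idle human drivers there. -/
noncomputable def hours (r NA : V → ℝ) (i : V) (s : ℝ) : ℝ :=
  s / (NA i + s) * ∑ j, (m.flow r i j (NA i + s) * m.t i j +
    m.flow r i j (NA i + s) * m.wp i (NA i + s)) + s

section pickup

variable {m} {r NA : V → ℝ}

lemma IsRegular.pickup_continuousOn (h : m.IsRegular r) (hNA : ∀ i, 0 ≤ NA i) (i : V) :
    ContinuousOn (m.pickup r NA i) (Ioi 0) :=
  (share_continuousOn (hNA i)).mul (comp_add_continuousOn (hNA i) <|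
    continuousOn_finsetSum _ fun j _ => h.flow_continuousOn i j)

lemma IsRegular.hours_continuousOn (h : m.IsRegular r) (hNA : ∀ i, 0 ≤ NA i) (i : V) :
    ContinuousOn (m.hours r NA i) (Ioi 0) :=
  ((share_continuousOn (hNA i)).mul (comp_add_continuousOn (hNA i)
    (f := fun n => ∑ j, (m.flow r i j n * m.t i j + m.flow r i j n * m.wp i n)) <|
    continuousOn_finsetSum _ fun j _ => ((h.flow_continuousOn i j).mul continuousOn_const).add
      ((h.flow_continuousOn i j).mul (h.wp_cont i)))).add continuousOn_id

lemma IsRegular.pickup_pos [Nonempty V] (h : m.IsRegular r) (hNA : ∀ i, 0 ≤ NA i) (i : V) {s : ℝ}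
    (hs : 0 < s) : 0 < m.pickup r NA i s := by
  have := hNA i
  exact mul_pos (by positivity)
    (Finset.sum_pos (fun j _ => h.flow_pos i j (by linarith)) Finset.univ_nonempty)

lemma IsRegular.pickup_mono (h : m.IsRegular r) (hNA : ∀ i, 0 ≤ NA i) (i : V) :
    MonotoneOn (m.pickup r NA i) (Ioi 0) := by
  intro a ha b hb hab
  have h0 := hNA i
  have ha' : (0 : ℝ) < a := ha
  have hb' : (0 : ℝ) < b := hb
  refine mul_le_mul (share_mono h0 ha hb hab) (Finset.sum_le_sum fun j _ => ?_)
    (Finset.sum_nonneg fun j _ => (h.flow_pos i j (by linarith)).le) (by positivity)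
  exact h.flow_mono i j (mem_Ioi.2 (by linarith)) (mem_Ioi.2 (by linarith)) (by linarith)

lemma IsRegular.pickup_le (h : m.IsRegular r) (hNA : ∀ i, 0 ≤ NA i) (i : V) {s : ℝ}
    (hs : 0 < s) : m.pickup r NA i s ≤ ∑ j, m.lam0 i j * m.Fp (r i * m.t i j) := by
  have h0 := hNA i
  have h1 : s / (NA i + s) ≤ 1 := (div_le_one (by linarith)).2 (by linarith)
  have h2 : 0 ≤ ∑ j, m.flow r i j (NA i + s) :=
    Finset.sum_nonneg fun j _ => (h.flow_pos i j (by linarith)).le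
  exact (mul_le_of_le_one_left h2 h1).trans
    (Finset.sum_le_sum fun j _ => h.flow_le i j (by linarith))

lemma IsRegular.tendsto_pickup (h : m.IsRegular r) (hNA : ∀ i, 0 ≤ NA i) (i : V) :
    Tendsto (m.pickup r NA i) (𝓝[>] 0) (𝓝 0) := by
  refine tendsto_share_mul (hNA i) (f := fun n => ∑ j, m.flow r i j n)
    (continuousOn_finsetSum _ fun j _ => h.flow_continuousOn i j) ?_
  simpa using tendsto_finsetSum Finset.univ fun j _ => h.tendsto_flow i j

lemma IsRegular.tendsto_hours (h : m.IsRegular r) (hNA : ∀ i, 0 ≤ NA i) (i : V) :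
    Tendsto (m.hours r NA i) (𝓝[>] 0) (𝓝 0) := by
  have h1 : Tendsto (fun n => ∑ j, (m.flow r i j n * m.t i j + m.flow r i j n * m.wp i n))
      (𝓝[>] 0) (𝓝 0) := by
    have := tendsto_finsetSum Finset.univ fun j _ =>
      ((h.tendsto_flow i j).mul_const (m.t i j)).add (h.tendsto_flow_mul_wp i j)
    simpa using this
  have h2 := tendsto_share_mul (hNA i) (f := fun n => ∑ j, (m.flow r i j n * m.t i j +
    m.flow r i j n * m.wp i n)) (continuousOn_finsetSum _ fun j _ =>
      ((h.flow_continuousOn i j).mul continuousOn_const).add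
      ((h.flow_continuousOn i j).mul (h.wp_cont i))) h1
  have h3 := h2.add (tendsto_id.mono_left (nhdsWithin_le_nhds (a := (0 : ℝ)) (s := Ioi 0)))
  rw [add_zero] at h3
  exact h3

lemma IsRegular.le_hours (h : m.IsRegular r) (hNA : ∀ i, 0 ≤ NA i) (i : V) {s : ℝ}
    (hs : 0 < s) : s ≤ m.hours r NA i s := by
  have h0 := hNA i
  have h1 : 0 < NA i + s := by linarith
  have h2 : 0 ≤ ∑ j, (m.flow r i j (NA i + s) * m.t i j +
      m.flow r i j (NA i + s) * m.wp i (NA i + s)) :=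
    Finset.sum_nonneg fun j _ => add_nonneg (mul_nonneg (h.flow_pos i j h1).le (m.t_pos i j).le)
      (mul_nonneg (h.flow_pos i j h1).le (h.wp_nonneg i _ h1))
  have h3 : 0 ≤ s / (NA i + s) := by positivity
  have := mul_nonneg h3 h2
  unfold hours
  linarith

end pickup

/-- Rate at which human drivers drop off passengers in zone `i`. -/
noncomputable def dropoff (m : Market V) (r NA x : V → ℝ) (i : V) : ℝ :=
  ∑ k, x k / (NA k + x k) * m.demand r (NA + x) k i

lemma sum_dropoff (m : Market V) (r NA x : V → ℝ) :
    ∑ i, m.dropoff r NA x i = ∑ i, m.pickup r NA i (x i) := by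
  unfold dropoff pickup
  rw [Finset.sum_comm]
  refine Finset.sum_congr rfl fun k _ => ?_
  rw [Finset.mul_sum]
  rfl

section revenue

variable {m} {r NA : V → ℝ}

lemma IsRegular.dropoff_nonneg (h : m.IsRegular r) (hNA : ∀ i, 0 ≤ NA i) {x : V → ℝ}
    (hx : ∀ i, 0 < x i) (i : V) : 0 ≤ m.dropoff r NA x i :=
  Finset.sum_nonneg fun k _ => mul_nonneg
    (div_nonneg (hx k).le (add_nonneg (hNA k) (hx k).le)) (h.demand_pos hNA hx k i).le

lemma IsRegular.sum_demand_pos [Nonempty V] (h : m.IsRegular r) (hNA : ∀ i, 0 ≤ NA i) {x : V → ℝ}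
    (hx : ∀ i, 0 < x i) (i : V) : 0 < ∑ j, m.demand r (NA + x) i j :=
  Finset.sum_pos (fun j _ => h.demand_pos hNA hx i j) Finset.univ_nonempty

lemma IsRegular.avgTrip_pos [Nonempty V] (h : m.IsRegular r) (hNA : ∀ i, 0 ≤ NA i) {x : V → ℝ}
    (hx : ∀ i, 0 < x i) (i : V) : 0 < m.avgTrip (m.demand r (NA + x)) i :=
  div_pos (Finset.sum_pos (fun j _ => mul_pos (h.demand_pos hNA hx i j) (m.t_pos i j))
    Finset.univ_nonempty) (h.sum_demand_pos hNA hx i)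

lemma IsRegular.revenue_pos [Nonempty V] (h : m.IsRegular r) (hNA : ∀ i, 0 ≤ NA i) {x : V → ℝ}
    (hx : ∀ i, 0 < x i) : 0 < m.revenue r (m.demand r (NA + x)) :=
  Finset.sum_pos (fun i _ => Finset.sum_pos (fun j _ => mul_pos (mul_pos (h.fare_pos i)
    (h.demand_pos hNA hx i j)) (m.t_pos i j)) Finset.univ_nonempty) Finset.univ_nonempty

/-- Keeping only trips within zone `i` suffices. The bound keeps the driver share `1 - δ` under
control, since it is the wage bill divided by revenue. -/
lemma IsRegular.le_revenue (h : m.IsRegular r) (hNA : ∀ i, 0 ≤ NA i) {x : V → ℝ}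
    (hx : ∀ i, 0 < x i) (i : V) {s : ℝ} (hs : 0 < s) (hsx : s ≤ x i) :
    r i * m.flow r i i s * m.t i i ≤ m.revenue r (m.demand r (NA + x)) := by
  have hpos : ∀ i j, 0 ≤ r i * m.demand r (NA + x) i j * m.t i j := fun i j =>
    (mul_pos (mul_pos (h.fare_pos i) (h.demand_pos hNA hx i j)) (m.t_pos i j)).le
  have h1 : r i * m.flow r i i s * m.t i i ≤ r i * m.demand r (NA + x) i i * m.t i i := by
    refine mul_le_mul_of_nonneg_right (mul_le_mul_of_nonneg_left ?_ (h.fare_pos i).le)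
      (m.t_pos i i).le
    have := hNA i
    have := hx i
    refine h.flow_mono i i hs ?_ ?_
    · change 0 < NA i + x i
      linarith
    · change s ≤ NA i + x i
      linarith
  refine h1.trans ((Finset.single_le_sum (f := fun j => r i * m.demand r (NA + x) i j * m.t i j)
    (fun j _ => hpos i j) (Finset.mem_univ i)).trans ?_)
  exact Finset.single_le_sum (f := fun i => ∑ j, r i * m.demand r (NA + x) i j * m.t i j)
    (fun i _ => Finset.sum_nonneg fun j _ => hpos i j) (Finset.mem_univ i)

end revenue

/-! ### Logit repositioning flows. -/

section reposition

variable [DecidableEq V] {m} {r NA : V → ℝ}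

lemma sum_repositionProb [Nonempty V] (r : V → ℝ) (δ : ℝ) (lam : V → V → ℝ) (wd : V → ℝ) (i : V) :
    ∑ j, m.repositionProb r δ lam wd i j = 1 := by
  unfold repositionProb
  rw [← Finset.sum_div, div_self]
  exact (Finset.sum_pos (fun k _ => Real.exp_pos _) Finset.univ_nonempty).ne'

lemma repositionProb_nonneg (r : V → ℝ) (δ : ℝ) (lam : V → V → ℝ) (wd : V → ℝ) (i j : V) :
    0 ≤ m.repositionProb r δ lam wd i j :=
  div_nonneg (Real.exp_pos _).le (Finset.sum_nonneg fun _ _ => (Real.exp_pos _).le)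

/-- The numerator is at least `1`, and each of the `card V` terms of the denominator is at most `exp
(η E)`. -/
lemma le_repositionProb [Nonempty V] {r : V → ℝ} {δ E : ℝ} {lam : V → V → ℝ} {wd : V → ℝ}
    {i : V} (h0 : ∀ j, 0 ≤ m.earningRate r δ lam wd i j)
    (hE : ∀ j, m.earningRate r δ lam wd i j ≤ E) (j : V) :
    1 / (Fintype.card V * Real.exp (m.η * E)) ≤ m.repositionProb r δ lam wd i j := by
  have hη := m.η_pos
  refine div_le_div₀ (Real.exp_pos _).le (Real.one_le_exp (mul_nonneg hη.le (h0 j)))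
    (Finset.sum_pos (fun _ _ => Real.exp_pos _) Finset.univ_nonempty) ?_
  calc ∑ k, Real.exp (m.η * m.earningRate r δ lam wd i k)
      ≤ ∑ _ : V, Real.exp (m.η * E) := Finset.sum_le_sum fun _ _ =>
        Real.exp_le_exp.2 (mul_le_mul_of_nonneg_left (hE _) hη.le)
    _ = Fintype.card V * Real.exp (m.η * E) := by simp

lemma sum_inducedHumanFlow [Nonempty V] (m : Market V) (q : ℝ) (r NA x : V → ℝ) (i : V) :
    ∑ j, m.inducedHumanFlow q r NA x i j = m.dropoff r NA x i := by
  simp only [inducedHumanFlow, humanFlow]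
  rw [← Finset.sum_mul, sum_repositionProb, one_mul]
  rfl

lemma IsRegular.inducedHumanFlow_nonneg (h : m.IsRegular r) (hNA : ∀ i, 0 ≤ NA i) {x : V → ℝ}
    (hx : ∀ i, 0 < x i) (q : ℝ) (i j : V) : 0 ≤ m.inducedHumanFlow q r NA x i j :=
  mul_nonneg (repositionProb_nonneg _ _ _ _ _ _) (h.dropoff_nonneg hNA hx i)

lemma sum_sum_inducedHumanFlow [Nonempty V] (m : Market V) (q : ℝ) (r NA x : V → ℝ) :
    ∑ i, ∑ j, m.inducedHumanFlow q r NA x j i = ∑ i, m.pickup r NA i (x i) := by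
  rw [Finset.sum_comm, ← sum_dropoff]
  exact Finset.sum_congr rfl fun i _ => m.sum_inducedHumanFlow q r NA x i

/-- The trip itself is part of the time spent, so the quotient of trip time by total time is at most
`1`. -/
lemma earningRate_mem {r : V → ℝ} {δ : ℝ} {lam : V → V → ℝ} {wd : V → ℝ} {i j : V}
    (hr : 0 ≤ r j) (hδ : 0 ≤ 1 - δ) (hlam : 0 < m.avgTrip lam j) (hwd : 0 ≤ wd j) :
    m.earningRate r δ lam wd i j ∈ Icc 0 ((1 - δ) * r j) := by
  have ht : (0 : ℝ) ≤ if j = i then 0 else m.t i j := by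
    split_ifs
    exacts [le_rfl, (m.t_pos i j).le]
  have hden : 0 < wd j + (if j = i then 0 else m.t i j) + m.avgTrip lam j := by linarith
  have hnum : 0 ≤ (1 - δ) * r j := mul_nonneg hδ hr
  refine ⟨div_nonneg (mul_nonneg hnum hlam.le) hden.le, ?_⟩
  unfold earningRate tripEarning
  rw [div_le_iff₀ hden]
  exact mul_le_mul_of_nonneg_left (by linarith) hnum

/-- If some zone has at least `s` idle human drivers, then the inflow of repositioning human
drivers into every zone is bounded below by a positive constant. -/
lemma IsRegular.exists_le_inflow [Nonempty V] (h : m.IsRegular r) (hNA : ∀ i, 0 ≤ NA i) {q : ℝ}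
    (hq : 0 ≤ q * m.drivers q) {s : ℝ} (hs : 0 < s) :
    ∃ c > 0, ∀ x : V → ℝ, (∀ i, 0 < x i) → (∃ i, s ≤ x i) →
      ∀ i, c ≤ ∑ j, m.inducedHumanFlow q r NA x j i := by
  obtain ⟨i₁, hi₁⟩ := Finite.exists_min fun i => r i * m.flow r i i s * m.t i i
  obtain ⟨i₂, hi₂⟩ := Finite.exists_min fun i => m.pickup r NA i s
  obtain ⟨i₃, hi₃⟩ := Finite.exists_max r
  -- `ρ` bounds revenue from below whichever zone holds `s` idle drivers, so `E` bounds all earning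
  -- rates uniformly in `x`.
  set ρ := r i₁ * m.flow r i₁ i₁ s * m.t i₁ i₁
  have hρ : 0 < ρ := mul_pos (mul_pos (h.fare_pos i₁) (h.flow_pos i₁ i₁ hs)) (m.t_pos i₁ i₁)
  set E := q * m.drivers q / ρ * r i₃
  have hp : 0 < 1 / (Fintype.card V * Real.exp (m.η * E)) := by
    have : 0 < Fintype.card V := Fintype.card_pos
    positivity
  refine ⟨1 / (Fintype.card V * Real.exp (m.η * E)) * m.pickup r NA i₂ s,
    mul_pos hp (h.pickup_pos hNA i₂ hs), fun x hx ⟨i₀, hi₀⟩ i => ?_⟩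
  have hrev := h.revenue_pos hNA hx
  have hδ : 0 ≤ 1 - (1 - q * m.drivers q / m.revenue r (m.demand r (NA + x))) := by
    rw [sub_sub_cancel]
    exact div_nonneg hq hrev.le
  have hδ' : 1 - (1 - q * m.drivers q / m.revenue r (m.demand r (NA + x))) ≤
      q * m.drivers q / ρ := by
    rw [sub_sub_cancel]
    exact div_le_div_of_nonneg_left hq hρ ((hi₁ i₀).trans (h.le_revenue hNA hx i₀ hs hi₀))
  have hprob : ∀ j, 1 / (Fintype.card V * Real.exp (m.η * E)) * m.dropoff r NA x j ≤
      m.inducedHumanFlow q r NA x j i := by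
    intro j
    refine mul_le_mul_of_nonneg_right ?_ (h.dropoff_nonneg hNA hx j)
    have hmem := fun k => earningRate_mem (m := m) (r := r) (i := j) (j := k)
      (wd := fun k => (NA + x) k / ∑ l, m.demand r (NA + x) k l) (h.fare_pos k).le hδ
      (h.avgTrip_pos hNA hx k)
      (div_nonneg (add_nonneg (hNA k) (hx k).le) (h.sum_demand_pos hNA hx k).le)
    refine le_repositionProb (fun k => (hmem k).1) (fun k => (hmem k).2.trans ?_) i
    exact mul_le_mul hδ' (hi₃ k) (h.fare_pos k).le (div_nonneg hq hρ.le)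
  calc 1 / (Fintype.card V * Real.exp (m.η * E)) * m.pickup r NA i₂ s
      ≤ 1 / (Fintype.card V * Real.exp (m.η * E)) * ∑ k, m.pickup r NA k (x k) := by
        refine mul_le_mul_of_nonneg_left ?_ hp.le
        exact ((hi₂ i₀).trans (h.pickup_mono hNA i₀ hs (hx i₀) hi₀)).trans
          (Finset.single_le_sum (f := fun k => m.pickup r NA k (x k))
            (fun k _ => (h.pickup_pos hNA k (hx k)).le) (Finset.mem_univ i₀))
    _ = ∑ j, 1 / (Fintype.card V * Real.exp (m.η * E)) * m.dropoff r NA x j := by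
        rw [← sum_dropoff, Finset.mul_sum]
    _ ≤ _ := Finset.sum_le_sum fun j _ => hprob j

lemma IsRegular.inflow_le [Nonempty V] (h : m.IsRegular r) (hNA : ∀ i, 0 ≤ NA i) (q : ℝ)
    {x : V → ℝ} (hx : ∀ i, 0 < x i) (i : V) :
    ∑ j, m.inducedHumanFlow q r NA x j i ≤ ∑ k, ∑ j, m.lam0 k j * m.Fp (r k * m.t k j) := by
  refine (Finset.single_le_sum (f := fun i => ∑ j, m.inducedHumanFlow q r NA x j i)
    (fun i _ => Finset.sum_nonneg fun j _ => h.inducedHumanFlow_nonneg hNA hx q j i)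
    (Finset.mem_univ i)).trans ?_
  rw [sum_sum_inducedHumanFlow]
  exact Finset.sum_le_sum fun k _ => h.pickup_le hNA k (hx k)

lemma IsRegular.inducedHumanFlow_continuousOn [Nonempty V] (h : m.IsRegular r)
    (hNA : ∀ i, 0 ≤ NA i) (q : ℝ) (i j : V) :
    ContinuousOn (fun x => m.inducedHumanFlow q r NA x i j) {x | ∀ i, 0 < x i} := by
  set U : Set (V → ℝ) := {x | ∀ i, 0 < x i}
  have hx : ∀ k, ContinuousOn (fun x : V → ℝ => x k) U := fun k => (continuous_apply k).continuousOn
  have hlam : ∀ k l, ContinuousOn (fun x => m.demand r (NA + x) k l) U := fun k l =>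
    (h.flow_continuousOn k l).comp (continuousOn_const.add (hx k)) fun x hxU =>
      add_pos_of_nonneg_of_pos (hNA k) (hxU k)
  have hsum : ∀ k, ContinuousOn (fun x => ∑ l, m.demand r (NA + x) k l) U := fun k =>
    continuousOn_finsetSum _ fun l _ => hlam k l
  have havg : ∀ k, ContinuousOn (fun x => m.avgTrip (m.demand r (NA + x)) k) U := fun k =>
    (continuousOn_finsetSum _ fun l _ => (hlam k l).mul continuousOn_const).div (hsum k)
      fun x hxU => (h.sum_demand_pos hNA hxU k).ne'
  have hwd : ∀ k, ContinuousOn (fun x => (NA + x) k / ∑ l, m.demand r (NA + x) k l) U := fun k =>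
    (continuousOn_const.add (hx k)).div (hsum k) fun x hxU => (h.sum_demand_pos hNA hxU k).ne'
  have hrev : ContinuousOn (fun x => m.revenue r (m.demand r (NA + x))) U :=
    continuousOn_finsetSum _ fun k _ => continuousOn_finsetSum _ fun l _ =>
      (continuousOn_const.mul (hlam k l)).mul continuousOn_const
  have hδ : ContinuousOn (fun x => 1 - q * m.drivers q / m.revenue r (m.demand r (NA + x))) U :=
    continuousOn_const.sub (continuousOn_const.div hrev fun x hxU => (h.revenue_pos hNA hxU).ne')
  have hrate : ∀ k, ContinuousOn (fun x => Real.exp (m.η * m.earningRate r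
      (1 - q * m.drivers q / m.revenue r (m.demand r (NA + x))) (m.demand r (NA + x))
      (fun k => (NA + x) k / ∑ l, m.demand r (NA + x) k l) i k)) U := by
    intro k
    refine Real.continuous_exp.comp_continuousOn (continuousOn_const.mul ?_)
    refine ContinuousOn.div (((continuousOn_const.sub hδ).mul continuousOn_const).mul (havg k))
      (((hwd k).add continuousOn_const).add (havg k)) fun x hxU => ?_
    have h1 := h.avgTrip_pos hNA hxU k
    have h2 : 0 ≤ (NA + x) k / ∑ l, m.demand r (NA + x) k l :=
      div_nonneg (add_nonneg (hNA k) (hxU k).le) (h.sum_demand_pos hNA hxU k).le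
    have ht : (0 : ℝ) ≤ if k = i then 0 else m.t i k := by
      split_ifs
      exacts [le_rfl, (m.t_pos i k).le]
    exact (by linarith : 0 < (NA + x) k / ∑ l, m.demand r (NA + x) k l +
      (if k = i then 0 else m.t i k) + m.avgTrip (m.demand r (NA + x)) k).ne'
  refine ContinuousOn.mul ((hrate j).div (continuousOn_finsetSum _ fun k _ => hrate k)
    fun x _ => (Finset.sum_pos (fun k _ => Real.exp_pos _) Finset.univ_nonempty).ne') ?_
  refine continuousOn_finsetSum _ fun k _ => ContinuousOn.mul ?_ (hlam k i)
  exact (hx k).div (continuousOn_const.add (hx k)) fun x hxU =>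
    (add_pos_of_nonneg_of_pos (hNA k) (hxU k)).ne'

end reposition

end Market

end RideSourcing

/-! ### Existence of a balanced distribution of idle drivers. -/

namespace RideSourcing

namespace Market

variable {V : Type*} [Fintype V]

/-- Positive flows with prescribed net inflows that sum to zero. -/
lemma exists_pos_flow [Nonempty V] {d : V → ℝ} (hd : ∑ i, d i = 0) :
    ∃ f : V → V → ℝ, (∀ i j, 0 < f i j) ∧ ∀ i, ∑ j, f j i = ∑ j, f i j + d i := by
  have hn : (0 : ℝ) < Fintype.card V := Nat.cast_pos.2 Fintype.card_pos
  obtain ⟨k, hk⟩ := Finite.exists_min d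
  -- The flow depends only on its destination: with `n = card V`, zone `i` receives `n + d i - d k`,
  -- and every zone sends `n - d k` because `d` sums to zero. Minimality of `d k` gives positivity.
  refine ⟨fun _ j => 1 + (d j - d k) / Fintype.card V, fun i j => ?_, fun i => ?_⟩
  · have := div_nonneg (sub_nonneg.2 (hk j)) hn.le
    linarith
  · simp only [Finset.sum_add_distrib, ← Finset.sum_div, Finset.sum_sub_distrib, hd,
      Finset.sum_const, Finset.card_univ, nsmul_eq_mul]
    field_simp
    ring

variable [DecidableEq V] {m : Market V} {r NA : V → ℝ}

/-- There is a positive distribution of idle human drivers that balances their flows and uses up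
exactly the available driver hours. -/
lemma IsRegular.exists_balanced [Nonempty V] (h : m.IsRegular r) (hNA : ∀ i, 0 ≤ NA i) {q : ℝ}
    (hq : 0 ≤ q) (hN : 0 < m.drivers q) :
    ∃ x : V → ℝ, (∀ i, 0 < x i) ∧
      (∀ i, ∑ j, m.inducedHumanFlow q r NA x j i = m.pickup r NA i (x i)) ∧
      ∑ i, m.hours r NA i (x i) = m.drivers q := by
  set N := m.drivers q
  set n : ℝ := (Fintype.card V : ℝ)
  have hn : 0 < n := Nat.cast_pos.2 Fintype.card_pos
  obtain ⟨ε₀, hε₀, hhours⟩ : ∃ ε₀ > 0, ∀ s, 0 < s → s < ε₀ →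
      ∀ i, m.hours r NA i s < N / (2 * n) := by
    have h1 : ∀ᶠ s in 𝓝[>] (0 : ℝ), ∀ i, m.hours r NA i s < N / (2 * n) :=
      eventually_all.2 fun i => (h.tendsto_hours hNA i).eventually_lt_const (by positivity)
    obtain ⟨ε₀, hε₀, hsub⟩ := mem_nhdsGT_iff_exists_Ioo_subset.1 h1
    exact ⟨ε₀, hε₀, fun s hs hs' => hsub ⟨hs, hs'⟩⟩
  have hlow : ∀ x : V → ℝ, (∀ i, 0 < x i) → (∀ i, x i < ε₀) →
      ∑ i, m.hours r NA i (x i) < N / 2 := by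
    intro x hx hxε
    calc ∑ i, m.hours r NA i (x i) < ∑ _i : V, N / (2 * n) :=
          Finset.sum_lt_sum_of_nonempty Finset.univ_nonempty fun i _ => hhours _ (hx i) (hxε i) i
      _ = n * (N / (2 * n)) := by simp [n]
      _ = N / 2 := by field_simp
  -- The order of choices matters: `c` depends on `ε₀`, and `ε` is then chosen so that pickups at
  -- `ε` are below both `c` and `N / 2`.
  obtain ⟨c, hc, hinflow⟩ := h.exists_le_inflow hNA (q := q) (mul_nonneg hq hN.le) hε₀
  obtain ⟨ε, hε, hεε₀, hpickup⟩ : ∃ ε > 0, ε < ε₀ ∧ ∀ i, m.pickup r NA i ε < min c (N / 2) := by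
    have h1 : ∀ᶠ s in 𝓝[>] (0 : ℝ), ∀ i, m.pickup r NA i s < min c (N / 2) :=
      eventually_all.2 fun i => (h.tendsto_pickup hNA i).eventually_lt_const (by positivity)
    obtain ⟨ε, hε, hε'⟩ := (h1.and (Ioo_mem_nhdsGT hε₀)).exists
    exact ⟨ε, hε'.1, hε'.2, hε⟩
  set B := ∑ k, ∑ j, m.lam0 k j * m.Fp (r k * m.t k j)
  have hB : 0 ≤ B := Finset.sum_nonneg fun k _ => Finset.sum_nonneg fun j _ =>
    mul_nonneg (m.lam0_pos k j).le (h.Fp_pos _ (h.fare_mul_pos k j)).le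
  -- On a face `x i = R` this gives `H - N ≥ B + 1` and `x i - ε ≥ 1`, so the penalty exceeds the
  -- inflow bound `B`.
  set R := N + B + 1 + ε
  have hεR : ε < R := by simp only [R]; linarith
  let G : (V → ℝ) → V → ℝ := fun x i =>
    ∑ j, m.inducedHumanFlow q r NA x j i - m.pickup r NA i (x i)
  let H : (V → ℝ) → ℝ := fun x => ∑ i, m.hours r NA i (x i)
  -- The factor `x i - ε` switches the penalty off on the lower face, where it would have the wrong
  -- sign.
  let F : (V → ℝ) → V → ℝ := fun x i => G x i + max (N - H x) 0 - (x i - ε) * max (H x - N) 0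
  have hpos : ∀ x ∈ Icc (fun _ : V => ε) (fun _ => R), ∀ i, 0 < x i := fun x hx i =>
    hε.trans_le (hx.1 i)
  have hG : ∀ x, ∑ i, G x i = 0 := by
    intro x
    simp only [G]
    rw [Finset.sum_sub_distrib, sum_sum_inducedHumanFlow, sub_self]
  have hF : ContinuousOn F (Icc (fun _ => ε) (fun _ => R)) := by
    have hx : ∀ k, ContinuousOn (fun x : V → ℝ => x k) {x | ∀ i, 0 < x i} :=
      fun k => (continuous_apply k).continuousOn
    have hH : ContinuousOn H {x | ∀ i, 0 < x i} :=
      continuousOn_finsetSum _ fun i _ => (h.hours_continuousOn hNA i).comp (hx i) fun x hx => hx i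
    refine ContinuousOn.mono ?_ hpos
    refine continuousOn_pi.2 fun i => ContinuousOn.sub (ContinuousOn.add (ContinuousOn.sub
      (continuousOn_finsetSum _ fun j _ => h.inducedHumanFlow_continuousOn hNA q j i) ?_) ?_) ?_
    · exact (h.pickup_continuousOn hNA i).comp (hx i) fun x hx => hx i
    · exact (continuousOn_const.sub hH).sup continuousOn_const
    · exact ((hx i).sub continuousOn_const).mul
        ((hH.sub continuousOn_const).sup continuousOn_const)
  have hFε : ∀ x ∈ Icc (fun _ : V => ε) (fun _ => R), ∀ i, x i = ε → 0 < F x i := by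
    intro x hx i hi
    have hx0 := hpos x hx
    have h1 := hpickup i
    have h2 : 0 ≤ max (N - H x) 0 := le_max_right _ _
    have h3 : N - H x ≤ max (N - H x) 0 := le_max_left _ _
    have h4 : 0 ≤ ∑ j, m.inducedHumanFlow q r NA x j i :=
      Finset.sum_nonneg fun j _ => h.inducedHumanFlow_nonneg hNA hx0 q j i
    have h5 := lt_min_iff.1 h1
    simp only [F, G, hi, sub_self, zero_mul, sub_zero]
    by_cases hlarge : ∃ i, ε₀ ≤ x i
    · have := hinflow x hx0 hlarge i
      linarith
    · push Not at hlarge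
      have h6 : H x < N / 2 := hlow x hx0 hlarge
      linarith
  have hFR : ∀ x ∈ Icc (fun _ : V => ε) (fun _ => R), ∀ i, x i = R → F x i < 0 := by
    intro x hx i hi
    have hx0 := hpos x hx
    have h1 : R ≤ H x := by
      calc R = x i := hi.symm
        _ ≤ m.hours r NA i (x i) := h.le_hours hNA i (hx0 i)
        _ ≤ H x := Finset.single_le_sum (f := fun i => m.hours r NA i (x i))
          (fun i _ => (hx0 i).le.trans (h.le_hours hNA i (hx0 i))) (Finset.mem_univ i)
    have h2 := h.inflow_le hNA q hx0 i
    have h3 := h.pickup_pos hNA i (hx0 i)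
    have h4 : B + 1 ≤ H x - N := by simp only [R] at h1; linarith
    have h5 : 1 ≤ x i - ε := by rw [hi]; simp only [R]; linarith
    have h6 : B + 1 ≤ (x i - ε) * (H x - N) := by nlinarith
    simp only [F, G]
    rw [max_eq_right (by linarith : N - H x ≤ 0), max_eq_left (by linarith : 0 ≤ H x - N)]
    linarith
  obtain ⟨x, hx, hFx⟩ := PoincareMiranda.exists_eq_zero hεR hF hFε hFR
  have hx0 := hpos x hx
  have hsum : n * max (N - H x) 0 - (∑ i, (x i - ε)) * max (H x - N) 0 = 0 := by
    have h1 : ∑ i, F x i = 0 := by simp [hFx]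
    simp only [F] at h1
    rw [Finset.sum_sub_distrib, Finset.sum_add_distrib, hG, ← Finset.sum_mul] at h1
    simpa [n] using h1
  have hHN : H x = N := by
    rcases lt_trichotomy (H x) N with hlt | heq | hgt
    · rw [max_eq_left (by linarith), max_eq_right (by linarith), mul_zero, sub_zero] at hsum
      have := mul_pos hn (sub_pos.2 hlt)
      linarith
    · exact heq
    -- With too many hours, the summed equation forces `x i = ε` for all `i`; but then `hlow` gives
    -- `H < N / 2`.
    · rw [max_eq_right (by linarith), max_eq_left (by linarith), mul_zero, zero_sub,
        neg_eq_zero] at hsum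
      have h1 : ∑ i, (x i - ε) = 0 :=
        (mul_eq_zero.1 hsum).resolve_right (sub_pos.2 hgt).ne'
      rw [Finset.sum_eq_zero_iff_of_nonneg fun i _ => sub_nonneg.2 (hx.1 i)] at h1
      have h2 := hlow x hx0 fun i => by
        have := h1 i (Finset.mem_univ i)
        linarith
      have h3 : H x < N / 2 := h2
      linarith
  refine ⟨x, hx0, fun i => ?_, hHN⟩
  have h1 := congrFun hFx i
  simp only [F, hHN, sub_self, max_self, mul_zero, sub_zero, add_zero, Pi.zero_apply, G] at h1
  linarith

end Market

end RideSourcing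

/-! ### Assembling the equilibrium. -/

theorem proposition1 {V : Type*} [Fintype V] [DecidableEq V] [Nonempty V]
    (m : RideSourcing.Market V) (q : ℝ) (r NA : V → ℝ)
    (hq : 0 < q) (hr : ∀ i, 0 < r i) (hNA : ∀ i, 0 ≤ NA i)
    (hFd : 0 < m.Fd q)
    (hFp_pos : ∀ c, 0 < c → 0 < m.Fp c)
    (hFp_cont : ContinuousOn m.Fp (Ioi 0))
    (hFp_anti : AntitoneOn m.Fp (Ioi 0))
    (hwp_nonneg : ∀ i n, 0 < n → 0 ≤ m.wp i n)
    (hwp_cont : ∀ i, ContinuousOn (m.wp i) (Ioi 0))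
    (hwp_anti : ∀ i, AntitoneOn (m.wp i) (Ioi 0))
    (h_noIdle : ∀ i j,
      Tendsto (fun n : ℝ => m.Fp (m.α * m.wp i n + r i * m.t i j)) (𝓝[>] 0) (𝓝 0))
    (h_longWait : ∀ i j,
      Tendsto (fun w : ℝ => w * m.Fp (m.α * w + r i * m.t i j)) atTop (𝓝 0))
    (h_flow : ∀ i,
      ∑ j, m.inducedHumanFlow q r NA (Pi.single i (m.drivers q)) i j ≤
        m.drivers q / (NA i + m.drivers q) *
          ∑ j, m.lam0 i j * m.Fp (m.α * m.wp i (m.drivers q + NA i) + r i * m.t i j)) :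
    ∃ o : RideSourcing.Outcome V,
      (∀ i, 0 < o.NH i) ∧ (∀ i j, 0 < o.lam i j) ∧ (∀ i, 0 < o.wd i) ∧
      (∀ i j, 0 < o.fA i j) ∧ ((∃ i, 0 < NA i) → 0 < o.NAtot) ∧
      m.IsEquilibrium q r NA o := by
  have h : m.IsRegular r := ⟨hr, hFp_pos, hFp_cont, hFp_anti, hwp_nonneg, hwp_cont, hwp_anti,
    h_noIdle, h_longWait⟩
  obtain ⟨x, hx, hbal, hhours⟩ := h.exists_balanced hNA hq.le (mul_pos m.N0_pos hFd)
  have hNI : ∀ i, 0 < (NA + x) i := fun i => add_pos_of_nonneg_of_pos (hNA i) (hx i)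
  have hlam := h.demand_pos hNA hx
  have hlam_sum := h.sum_demand_pos hNA hx
  have hshare : ∀ i, 0 ≤ NA i / (NA i + x i) := fun i => div_nonneg (hNA i) (hNI i).le
  set lam := m.demand r (NA + x)
  obtain ⟨fA, hfA, hfA_bal⟩ := RideSourcing.Market.exists_pos_flow
    (d := fun i => ∑ j, NA i / (NA i + x i) * lam i j - ∑ j, NA j / (NA j + x j) * lam j i)
    -- Over all zones, AV departures with passengers equal AV arrivals with passengers.
    (by rw [Finset.sum_sub_distrib, sub_eq_zero]; exact Finset.sum_comm)
  refine ⟨⟨x, NA + x, lam, fun k => (NA + x) k / ∑ l, lam k l,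
    1 - q * m.drivers q / m.revenue r lam, m.inducedHumanFlow q r NA x, fA,
    (∑ i, ∑ j, NA i / (NA i + x i) * lam i j * m.t i j) +
      (∑ i, ∑ j, NA i / (NA i + x i) * lam i j * m.wp i ((NA + x) i)) + ∑ i, NA i⟩, hx, hlam,
    fun i => div_pos (hNI i) (hlam_sum i), hfA, fun ⟨i, hi⟩ => ?_,
    { demand := fun i j => rfl
      idle := fun i => rfl
      wait := fun i => (div_mul_cancel₀ _ (hlam_sum i).ne').symm
      reposition := fun i j => rfl
      wage := ?_
      balanceH := fun i => ?_
      balanceA := fun i => ?_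
      hoursH := ?_
      hoursA := rfl }⟩
  · refine add_pos_of_nonneg_of_pos (add_nonneg ?_ ?_) ?_
    · exact Finset.sum_nonneg fun i _ => Finset.sum_nonneg fun j _ =>
        mul_nonneg (mul_nonneg (hshare i) (hlam i j).le) (m.t_pos i j).le
    · exact Finset.sum_nonneg fun i _ => Finset.sum_nonneg fun j _ =>
        mul_nonneg (mul_nonneg (hshare i) (hlam i j).le) (hwp_nonneg i _ (hNI i))
    · exact Finset.sum_pos' (fun i _ => hNA i) ⟨i, Finset.mem_univ i, hi⟩
  · change _ = (1 - (1 - q * m.drivers q / m.revenue r lam)) * m.revenue r lam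
    rw [sub_sub_cancel, div_mul_cancel₀ _ (h.revenue_pos hNA hx).ne']
  -- Total repositioning outflow is the drop-off rate, which is also the occupied inflow; `hbal`
  -- matches the two remaining terms.
  · rw [Finset.sum_add_distrib, Finset.sum_add_distrib, m.sum_inducedHumanFlow, hbal i, add_comm,
      ← Finset.mul_sum]
    rfl
  · rw [Finset.sum_add_distrib, Finset.sum_add_distrib, hfA_bal i]
    ring
  · change m.drivers q = _
    rw [← hhours, ← Finset.sum_add_distrib, ← Finset.sum_add_distrib]
    refine Finset.sum_congr rfl fun i _ => ?_
    unfold RideSourcing.Market.hours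
    rw [← Finset.sum_add_distrib, Finset.mul_sum]
    refine congrArg (· + x i) (Finset.sum_congr rfl fun j _ => ?_)
    rw [mul_add, ← mul_assoc, ← mul_assoc]
    rfl
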